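/- Theorem. Let $\alpha\in\mathbb{R}\setminus\mathbb{Q}$ and let $c=h/k\in(0,1)$ with $h,k$ coprime positive integers. For $n\ge 0$ put $D_n(\alpha,c)=\#\{1\le j\le n:\{j\alpha\}<c\}-cn$, where $\{\cdot\}$ is the fractional part. Let $\alpha=[a_0;a_1,a_2,\dots]$ be the continued fraction of $\alpha$, and let $q_{-2}=1$, $q_{-1}=0$, $q_n=a_nq_{n-1}+q_{n-2}$ $(n\ge 0)$ be the denominators of its convergents. For a finite (possibly empty) tuple of integers $M=(b_0,\dots,b_m)$, $m\ge -1$, put $q^M_{-2}=1$, $q^M_{-1}=0$, $q^M_n=b_nq^M_{n-1}+q^M_{n-2}$ for $0\le n\le m$. The tuple $M$ is called of type-$k$ if the residues of $q^M_{m-1}$ and $q^M_m$ modulo $k$ in $\{0,1,\dots,k-1\}$ are $j$ and $0$ respectively, for some $j\in\{1,\dots,k-1\}$. Then the following three statements are equivalent: 1. $\sup_n D_n(\alpha,c)<+\infty$ (resp. $\inf_n D_n(\alpha,c)>-\infty$); 2. there exists an even (resp. odd) integer $m\ge -1$ such that $k\mid q_{m+2n}$ for all $n\ge 0$; 3. there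 exists an even (resp. odd) integer $m\ge -1$ such that $(a_0,a_1,\dots,a_m)$ is of type-$k$ and $k\mid a_{m+2n}$ for all $n\ge 1$. -/

import Mathlib

namespace LocalDiscrepancy

/-- The local discrepancy `D_n(ω, c) = ∑_{j=1}^n 1_{[0,c)}(ω_j) - n c` of a sequence `ω` at `c`. -/
noncomputable def discrepancy (ω : ℕ → ℝ) (c : ℝ) (n : ℕ) : ℝ :=
  ∑ j ∈ Finset.Icc 1 n, (Set.Ico 0 c).indicator (fun _ => (1 : ℝ)) (ω j) - n * c

/-- `D_n(α, c)`, the local discrepancy at `c` of the sequence `({jα})_{j ≥ 1}`. -/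
noncomputable def D (α c : ℝ) (n : ℕ) : ℝ :=
  discrepancy (fun j => Int.fract (j * α)) c n

/-- The `n`-th partial quotient `a_n` of the continued fraction `[a_0; a_1, a_2, …]` of `α`, as an
integer, read off Mathlib's continued fraction algorithm. For irrational `α` the algorithm never
stops, so the default value `0` is not used. -/
noncomputable def partialQuotient (α : ℝ) (n : ℕ) : ℤ :=
  ((GenContFract.IntFractPair.stream α n).map GenContFract.IntFractPair.b).getD 0

/-- The denominators attached to `(a_n)`, with the index shifted by two:
`shiftedDen a i` is `q_{i-2}`. -/
def shiftedDen (a : ℕ → ℤ) : ℕ → ℤ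
  | 0 => 1
  | 1 => 0
  | n + 2 => a n * shiftedDen a (n + 1) + shiftedDen a n

/-- The denominators `q_n`, `n ≥ -2`, attached to `(a_n)`: `q_{-2} = 1`, `q_{-1} = 0` and
`q_n = a_n q_{n-1} + q_{n-2}` for `n ≥ 0`. (Indices below `-2` are not used.) -/
def den (a : ℕ → ℤ) (n : ℤ) : ℤ :=
  shiftedDen a (n + 2).toNat

/-- The denominators `q_n`, `n ≥ -2`, of the convergents of `α`. -/
noncomputable def convDen (α : ℝ) (n : ℤ) : ℤ :=
  den (partialQuotient α) n

/-- The denominators `q^M_n` of a tuple `M = (a_0, …, a_m)`, for `-2 ≤ n ≤ m`; only the entries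
of `M` enter in that range. -/
def tupleDen (M : List ℤ) (n : ℤ) : ℤ :=
  den (fun i => M.getD i 0) n

/-- The character `κ(M) = (q^M_{m-1} mod k, q^M_m mod k)` of `M = (a_0, …, a_m)`; here `m` is the
number of entries minus one, so that `m = -1` for the empty tuple. -/
def character (k : ℕ) (M : List ℤ) : ℤ × ℤ :=
  let m : ℤ := (M.length : ℤ) - 1
  (tupleDen M (m - 1) % (k : ℤ), tupleDen M m % (k : ℤ))

/-- The tuple `M` is of type-`k`: `κ(M) = (j, 0)` for some `j ∈ {1, …, k - 1}`. -/
def IsOfType (k : ℕ) (M : List ℤ) : Prop :=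
  ∃ j : ℤ, 1 ≤ j ∧ j ≤ (k : ℤ) - 1 ∧ character k M = (j, 0)

/-- The tuple `(a_0, …, a_m)` of the first `m + 1` partial quotients of `α`, for `m ≥ -1`. -/
noncomputable def initialTuple (α : ℝ) (m : ℤ) : List ℤ :=
  (List.range (m + 1).toNat).map (partialQuotient α)

end LocalDiscrepancy

/-!
Two facts carry the proof. The arguments work with abstract approximations `p_i / q_i` of a real
`x` whose even-indexed terms lie below `x` (`IsConvergentSeq`); taking `x = α` gives the first
half of the theorem, and `x = -α` with `D(-α, c) = -D(α, 1 - c)` gives the second. Write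
`δ_i = |q_i x - p_i|` and `c = h / k`.

*Divisibility implies boundedness.* Suppose that `k ∣ q_i` for all even `i`. Then `c ≡ M x - θ`
modulo `1`, where `M = s q_0 / k`, `θ = s δ_0 / k` and `s p_0 ≡ h` modulo `k`. The interval
`[0, M x)` has bounded discrepancy, as its centred indicator is a coboundary, so an upper bound for
`D_N(x, c)` follows if the orbit visits `[-θ, 0)` at least as often as expected
(`D_le_sub_card`). In the coordinates given by the unimodular matrix of two consecutive
approximations, these visits are the visits to `[0, s / k)` of the rotation by
`β = δ_1 / δ_0 = [0; a_0, a_1, …]`, where now `k ∣ a_i` for all even `i`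
(`le_card_fract_of_D_nonneg`). For such `β` the discrepancy is never negative: as
`k ∣ a_0`, each lap around the circle contains `s a_0 / k` visits, or one more, and the extra
visits are those of the rotation by `[0; a_2, a_3, …]`, so induction on time applies
(`le_hitCount`).

*Boundedness implies divisibility.* If `D_Q > 0` for return times `Q` with `Q x` arbitrarily close
to `0` from the right, such times can be concatenated and the discrepancy is unbounded above
(`not_bddAbove_D`). So `D_{q_i} ≤ 0` for all large even `i`. If moreover `k ∤ q_i`, a pigeonhole
argument gives a time `j ≤ q_i` at which `j x` is just to the right of `c`. Expressing
`(k j, k (c + z))`, with `c + z` the translate of `c` next to `j x`, in the basis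
`(q_i, p_i)`, `(q_{i-1}, p_{i-1})` shows that the residue of `-h q_{i-1}` modulo `k` strictly
decreases from `i` to `i + 2` (`emod_lt_emod_of_D_nonpos`), while it stays the same if `k ∣ q_i`.
So `k ∤ q_i` happens only finitely often.
-/

namespace LocalDiscrepancy

/-! ### Rotations with partial quotients divisible by `k` -/

/-- The number of `0 ≤ j < n` with `{jβ} < c`. Unlike in `D`, the index `j = 0` is counted. -/
noncomputable def hitCount (β c : ℝ) (n : ℕ) : ℕ :=
  ((Finset.range n).filter fun j : ℕ => Int.fract ((j : ℝ) * β) < c).card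

theorem hitCount_zero (β c : ℝ) : hitCount β c 0 = 0 := by simp [hitCount]

theorem hitCount_succ (β c : ℝ) (n : ℕ) :
    hitCount β c (n + 1) = hitCount β c n + if Int.fract ((n : ℝ) * β) < c then 1 else 0 := by
  unfold hitCount
  rw [Finset.range_add_one, Finset.filter_insert]
  split_ifs with h
  · rw [Finset.card_insert_of_notMem (by simp)]
  · simp

theorem hitCount_mono (β c : ℝ) : Monotone (hitCount β c) :=
  monotone_nat_of_le_succ fun n => by rw [hitCount_succ]; omega

theorem hitCount_add_of_forall (β c : ℝ) (n d : ℕ)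
    (h : ∀ t < d, Int.fract (((n + t : ℕ) : ℝ) * β) < c) :
    hitCount β c (n + d) = hitCount β c n + d := by
  induction d with
  | zero => rfl
  | succ d ih =>
    rw [← add_assoc, hitCount_succ, if_pos (h d (by omega)), ih fun t ht => h t (by omega)]
    ring

theorem hitCount_add_of_forall_not (β c : ℝ) (n d : ℕ)
    (h : ∀ t < d, ¬ Int.fract (((n + t : ℕ) : ℝ) * β) < c) :
    hitCount β c (n + d) = hitCount β c n := by
  induction d with
  | zero => rfl
  | succ d ih =>
    rw [← add_assoc, hitCount_succ, if_neg (h d (by omega)), ih fun t ht => h t (by omega)]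
    rfl

theorem D_eq_card (α c : ℝ) (n : ℕ) :
    D α c n = ((Finset.Icc 1 n).filter fun j : ℕ => Int.fract ((j : ℝ) * α) < c).card - n * c := by
  unfold D discrepancy
  congr 1
  rw [Finset.card_filter, Nat.cast_sum]
  refine Finset.sum_congr rfl fun j _ => ?_
  simp [Set.indicator_apply, Set.mem_Ico, Int.fract_nonneg]

theorem D_zero (α c : ℝ) : D α c 0 = 0 := by simp [D_eq_card]

theorem D_succ (α c : ℝ) (n : ℕ) :
    D α c (n + 1) = D α c n + ((if Int.fract (((n + 1 : ℕ) : ℝ) * α) < c then 1 else 0) - c) := by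
  rw [D_eq_card, D_eq_card, ← Finset.insert_Icc_right_eq_Icc_add_one (by omega), Finset.filter_insert]
  split_ifs with h
  · rw [Finset.card_insert_of_notMem (by simp)]
    push_cast; ring
  · push_cast; ring

theorem hitCount_succ_eq_D (α : ℝ) {c : ℝ} (hc : 0 < c) (n : ℕ) :
    (hitCount α c (n + 1) : ℝ) = D α c n + n * c + 1 := by
  induction n with
  | zero => simp [hitCount_succ, D_zero, hc, hitCount_zero]
  | succ n ih =>
    rw [hitCount_succ, Nat.cast_add, ih, D_succ]
    push_cast; ring

/-- One turn of the renormalization: `β = 1 / (a₀ + β₁)`, `β₁ = 1 / (a₁ + β₂)`, `a₀ = k A` and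
`c = s / k`. The lap `L` of the rotation by `β` starts at time `L a₀ + ⌈L β₁⌉`; each lap contains
`s A` hits of `[0, c)`, and one more if it contains a hit of the rotation by `β₂`. -/
theorem hitCount_lap_le {β β₁ β₂ : ℝ} {k s A a₁ : ℕ} (hk : 0 < k) (hs : s ≤ k)
    (hβ : 0 < β) (hβ₁ : 0 < β₁) (hβ₁' : β₁ < 1)
    (h₀ : β * ((k * A : ℕ) + β₁) = 1) (h₁ : β₁ * (a₁ + β₂) = 1) (L : ℕ) :
    s * A * L + hitCount β₂ (s / k) ⌈L * β₁⌉₊ ≤ hitCount β (s / k) (L * (k * A) + ⌈L * β₁⌉₊) := by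
  have hkR : (0 : ℝ) < k := by exact_mod_cast hk
  have hc1 : (s : ℝ) / k ≤ 1 := by
    rw [div_le_one hkR]; exact_mod_cast hs
  have hc0 : (0 : ℝ) ≤ (s : ℝ) / k := by positivity
  have hcβ : (s : ℝ) / k = (s * A + s / k * β₁) * β := by
    push_cast at h₀
    have : (s : ℝ) / k * k = s := by field_simp
    linear_combination (-(s / k : ℝ)) * h₀ + A * β * this
  induction L with
  | zero => simp [hitCount_zero]
  | succ L ih =>
    set m := ⌈(L : ℝ) * β₁⌉₊ with hm
    set m' := ⌈((L + 1 : ℕ) : ℝ) * β₁⌉₊ with hm'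
    have hLm : (L : ℝ) * β₁ ≤ m := Nat.le_ceil _
    have hmL : (m : ℝ) < L * β₁ + 1 := Nat.ceil_lt_add_one (by positivity)
    have hmm : m ≤ m' := Nat.ceil_mono (by push_cast; nlinarith)
    have hmm' : m' ≤ m + 1 := by
      rw [hm', Nat.ceil_le]; push_cast; nlinarith
    have hsA : s * A ≤ k * A := Nat.mul_le_mul_right A hs
    -- The `t`-th point of the lap lies at `(m - L β₁ + t) β`, and `c = (s A + c β₁) β`.
    have key : ∀ T ≤ k * A + (m' - m), ((m : ℝ) - L * β₁ + T - 1 < s * A + s / k * β₁) →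
        hitCount β (s / k) (L * (k * A) + m) + T ≤ hitCount β (s / k) ((L + 1) * (k * A) + m') := by
      intro T hT hlt
      rw [← hitCount_add_of_forall]
      · refine hitCount_mono _ _ ?_
        rw [add_mul]; omega
      · intro t ht
        have htT : (t : ℝ) + 1 ≤ T := by exact_mod_cast ht
        have e : ((L * (k * A) + m + t : ℕ) : ℝ) * β = ((m : ℝ) - L * β₁ + t) * β + (L : ℤ) := by
          push_cast at h₀ ⊢
          linear_combination (L : ℝ) * h₀
        have hlt' : ((m : ℝ) - L * β₁ + t) * β < s / k := by
          rw [hcβ]; exact mul_lt_mul_of_pos_right (by linarith) hβ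
        have hnn : 0 ≤ ((m : ℝ) - L * β₁ + t) * β :=
          mul_nonneg (by have : (0 : ℝ) ≤ t := by positivity
                         linarith) hβ.le
        rw [e, Int.fract_add_intCast, Int.fract_eq_self.2 ⟨hnn, by linarith⟩]
        exact hlt'
    have base : hitCount β (s / k) (L * (k * A) + m) + s * A
        ≤ hitCount β (s / k) ((L + 1) * (k * A) + m') :=
      key (s * A) (by omega) (by
        have : 0 ≤ (s : ℝ) / k * β₁ := by positivity
        push_cast; linarith)
    rcases hmm.eq_or_lt with h | h
    · rw [← h] at base
      rw [← h, mul_add, mul_one]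
      omega
    · have h' : m' = m + 1 := by omega
      rw [h', hitCount_succ, mul_add, mul_one]
      rw [h'] at base key
      split_ifs with hit
      · have hlt : (m : ℝ) < (L + 1 : ℕ) * β₁ := Nat.lt_ceil.1 h
        push_cast at hlt
        have e : (m : ℝ) * β₂ = ((m : ℝ) - L * β₁) / β₁ + ((L - m * a₁ : ℤ) : ℝ) := by
          push_cast; field_simp; linear_combination (m : ℝ) * h₁
        rw [e, Int.fract_add_intCast, Int.fract_eq_self.2
          ⟨div_nonneg (by linarith) hβ₁.le, by rw [div_lt_one hβ₁]; linarith⟩, div_lt_iff₀ hβ₁] at hit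
        have := key (s * A + 1) (by omega) (by push_cast; linarith)
        omega
      · omega

/-- If `β₀ = 1 / (a₀ + 1 / (a₁ + ⋯))` with `k ∣ a₀, a₂, a₄, …`, the rotation by `β₀` visits
`[0, s / k)` at least as often as expected, at every time. Within one lap around the circle the
visits come first, so the worst times are the ends of the laps, and these reduce to the rotation
by `β₂`. -/
theorem le_hitCount {k s : ℕ} (hk : 0 < k) (hs0 : 0 < s) (hs : s ≤ k) (n : ℕ) (β : ℕ → ℝ)
    (a : ℕ → ℕ) (hβ : ∀ i, 0 < β i) (hβ1 : ∀ i, β i < 1)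
    (hrec : ∀ i, β i * (a i + β (i + 1)) = 1) (hdvd : ∀ i, k ∣ a (2 * i)) :
    (s / k : ℝ) * n + 1 ≤ hitCount (β 0) (s / k) (n + 1) := by
  have hkR : (0 : ℝ) < k := by exact_mod_cast hk
  have hc1 : (s : ℝ) / k ≤ 1 := by
    rw [div_le_one hkR]; exact_mod_cast hs
  have hc0 : (0 : ℝ) < (s : ℝ) / k := by positivity
  induction n using Nat.strong_induction_on generalizing β a with
  | _ n ih =>
    rcases Nat.eq_zero_or_pos n with rfl | hn
    · simp [hitCount_succ, hc0, hitCount_zero]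
    obtain ⟨A, hA⟩ := hdvd 0
    rw [Nat.mul_zero] at hA
    have h₀ := hrec 0
    rw [hA] at h₀
    have ends : ∀ L : ℕ, 0 < L → L ≤ n → (s / k : ℝ) * ((L * (k * A) + ⌈L * β 1⌉₊ : ℕ) - 1) + 1
        ≤ hitCount (β 0) (s / k) (L * (k * A) + ⌈L * β 1⌉₊) := by
      intro L hL hLn
      have lap := hitCount_lap_le hk hs (hβ 0) (hβ 1) (hβ1 1) h₀ (hrec 1) L
      have hpos : 0 < ⌈L * β 1⌉₊ := Nat.ceil_pos.2 (mul_pos (by exact_mod_cast hL) (hβ 1))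
      have hle : ⌈L * β 1⌉₊ ≤ L := by
        rw [Nat.ceil_le]
        have : (0 : ℝ) < L := by exact_mod_cast hL
        nlinarith [hβ1 1]
      obtain ⟨m, hm⟩ : ∃ m, ⌈L * β 1⌉₊ = m + 1 := ⟨_, (Nat.sub_add_cancel hpos).symm⟩
      rw [hm] at lap hle ⊢
      have := ih m (by omega) (fun i => β (i + 2)) (fun i => a (i + 2)) (fun i => hβ _)
        (fun i => hβ1 _) (fun i => hrec _) (fun i => hdvd (i + 1))
      have lapR : ((s * A * L + hitCount (β 2) (s / k) (m + 1) : ℕ) : ℝ)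
          ≤ hitCount (β 0) (s / k) (L * (k * A) + (m + 1)) := by exact_mod_cast lap
      push_cast at lapR ⊢
      have e : (s / k : ℝ) * (L * (k * A) + (m + 1) - 1) = s * A * L + s / k * m := by
        field_simp; ring
      simp only [zero_add] at this
      rw [e]; linarith
    have start : ∀ L : ℕ, ((L * (k * A) + ⌈L * β 1⌉₊ : ℕ) : ℝ) * β 0
        = (⌈L * β 1⌉₊ - L * β 1) * β 0 + L := by
      intro L; push_cast at h₀ ⊢; linear_combination (L : ℝ) * h₀
    set L := ⌊(n : ℝ) * β 0⌋₊ with hL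
    have hLn : (L : ℝ) ≤ n * β 0 := Nat.floor_le (mul_nonneg (Nat.cast_nonneg _) (hβ 0).le)
    have hnL : (n : ℝ) * β 0 < L + 1 := Nat.lt_floor_add_one _
    have hLn' : L < n := by
      have hnR : (0 : ℝ) < n := by exact_mod_cast hn
      have : (L : ℝ) < n := by nlinarith [hβ1 0]
      exact_mod_cast this
    have hJ : L * (k * A) + ⌈L * β 1⌉₊ ≤ n := by
      by_contra! hcon
      have h1 : ((n + 1 : ℕ) : ℝ) ≤ (L * (k * A) + ⌈L * β 1⌉₊ : ℕ) := by exact_mod_cast hcon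
      have h2 := mul_le_mul_of_nonneg_right h1 (hβ 0).le
      rw [start] at h2
      have h3 : (⌈L * β 1⌉₊ : ℝ) < L * β 1 + 1 :=
        Nat.ceil_lt_add_one (mul_nonneg (Nat.cast_nonneg _) (hβ 1).le)
      push_cast at h2
      nlinarith [hβ 0]
    have hJ' : n + 1 ≤ (L + 1) * (k * A) + ⌈((L + 1 : ℕ) : ℝ) * β 1⌉₊ := by
      by_contra! hcon
      have h1 : (((L + 1) * (k * A) + ⌈((L + 1 : ℕ) : ℝ) * β 1⌉₊ : ℕ) : ℝ) ≤ n := by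
        exact_mod_cast Nat.lt_succ_iff.1 hcon
      have h2 := mul_le_mul_of_nonneg_right h1 (hβ 0).le
      rw [start] at h2
      have h3 : ((L + 1 : ℕ) : ℝ) * β 1 ≤ ⌈((L + 1 : ℕ) : ℝ) * β 1⌉₊ := Nat.le_ceil _
      have h4 := mul_nonneg (sub_nonneg.2 h3) (hβ 0).le
      push_cast at h2 h4
      linarith
    have fract_eq : ∀ j : ℕ, L * (k * A) + ⌈L * β 1⌉₊ ≤ j →
        j < (L + 1) * (k * A) + ⌈((L + 1 : ℕ) : ℝ) * β 1⌉₊ →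
        Int.fract ((j : ℝ) * β 0) = j * β 0 - L := by
      intro j hj hj'
      rw [Int.fract_eq_iff]
      refine ⟨?_, ?_, L, by push_cast; ring⟩
      · have h1 : ((L * (k * A) + ⌈L * β 1⌉₊ : ℕ) : ℝ) ≤ j := by exact_mod_cast hj
        have h2 := mul_le_mul_of_nonneg_right h1 (hβ 0).le
        rw [start] at h2
        have h4 := mul_nonneg (sub_nonneg.2 (Nat.le_ceil ((L : ℝ) * β 1))) (hβ 0).le
        linarith
      · have h1 : ((j + 1 : ℕ) : ℝ) ≤ ((L + 1) * (k * A) + ⌈((L + 1 : ℕ) : ℝ) * β 1⌉₊ : ℕ) := by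
          exact_mod_cast hj'
        have h2 := mul_le_mul_of_nonneg_right h1 (hβ 0).le
        rw [start] at h2
        have h3 : (⌈((L + 1 : ℕ) : ℝ) * β 1⌉₊ : ℝ) < ((L + 1 : ℕ) : ℝ) * β 1 + 1 :=
          Nat.ceil_lt_add_one (mul_nonneg (Nat.cast_nonneg _) (hβ 1).le)
        push_cast at h2 h3
        nlinarith [hβ 0]
    by_cases hit : Int.fract ((n : ℝ) * β 0) < s / k
    · -- All times of the current lap up to `n` are hits.
      obtain ⟨d, hd⟩ := Nat.exists_eq_add_of_le (Nat.le_succ_of_le hJ)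
      have cnt := hitCount_add_of_forall (β 0) (s / k) (L * (k * A) + ⌈L * β 1⌉₊) d (by
        intro t ht
        rw [fract_eq _ (by omega) (by omega)]
        rw [fract_eq _ hJ (by omega)] at hit
        refine lt_of_le_of_lt ?_ hit
        have : ((L * (k * A) + ⌈L * β 1⌉₊ + t : ℕ) : ℝ) ≤ n := by
          exact_mod_cast (by omega : L * (k * A) + ⌈L * β 1⌉₊ + t ≤ n)
        have := mul_le_mul_of_nonneg_right this (hβ 0).le
        linarith)
      have hd1 : 1 ≤ d := by omega
      have hd1R : (1 : ℝ) ≤ d := by exact_mod_cast hd1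
      rw [← Nat.succ_eq_add_one, hd, cnt]
      have hnR : (n : ℝ) + 1 = (L * (k * A) + ⌈L * β 1⌉₊ : ℕ) + d := by exact_mod_cast hd
      rcases Nat.eq_zero_or_pos L with h0 | h0
      · rw [h0] at hnR ⊢
        simp only [zero_mul, Nat.cast_zero, Nat.ceil_zero, add_zero] at hnR ⊢
        push_cast; nlinarith
      · have := ends L h0 hLn'.le
        push_cast at this hnR ⊢
        nlinarith
    · -- No time of the current lap after `n` is a hit.
      obtain ⟨d, hd⟩ := Nat.exists_eq_add_of_le hJ'
      have cnt := hitCount_add_of_forall_not (β 0) (s / k) (n + 1) d (by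
        intro t ht
        rw [fract_eq _ (by omega) (by omega)]
        rw [fract_eq _ hJ (by omega)] at hit
        have : (n : ℝ) ≤ (n + 1 + t : ℕ) := by exact_mod_cast (by omega : n ≤ n + 1 + t)
        have := mul_le_mul_of_nonneg_right this (hβ 0).le
        linarith)
      have := ends (L + 1) (by omega) (by omega)
      rw [← cnt, ← hd]
      refine le_trans ?_ this
      have hnR : ((n + 1 : ℕ) : ℝ) ≤ ((L + 1) * (k * A) + ⌈((L + 1 : ℕ) : ℝ) * β 1⌉₊ : ℕ) := by
        exact_mod_cast hJ'
      have := mul_le_mul_of_nonneg_left hnR hc0.le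
      push_cast at this ⊢
      linarith

theorem D_nonneg {k s : ℕ} (hk : 0 < k) (hs0 : 0 < s) (hs : s ≤ k) (n : ℕ) (β : ℕ → ℝ)
    (a : ℕ → ℕ) (hβ : ∀ i, 0 < β i) (hβ1 : ∀ i, β i < 1)
    (hrec : ∀ i, β i * (a i + β (i + 1)) = 1) (hdvd : ∀ i, k ∣ a (2 * i)) :
    0 ≤ D (β 0) (s / k) n := by
  have := le_hitCount hk hs0 hs n β a hβ hβ1 hrec hdvd
  rw [hitCount_succ_eq_D _ (by positivity)] at this
  linarith

/-! ### Approximations from alternating sides -/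

/-- The error `(-1) ^ i (q_i x - p_i)` of the `i`-th approximation `p_i / q_i` to `x`, with the sign
that makes it positive when even-indexed approximations lie below `x`. -/
noncomputable def err (x : ℝ) (q p : ℕ → ℤ) (i : ℕ) : ℝ := (-1) ^ i * (q i * x - p i)

/-- `p_i / q_i` behaves like the sequence of convergents of `x`, started at an index at which the
convergent lies below `x`: it satisfies the recurrence with partial quotients `a_i ≥ 1` (here `a_i`
enters `q_{i+2}`), consecutive terms are unimodular, and the signed errors alternate and decrease.
Both the convergents of `α` from index `0` on and, with the sign of the numerators changed, the
convergents of `-α` from index `-1` on have this form, which treats the two parities at once. -/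
structure IsConvergentSeq (x : ℝ) (a q p : ℕ → ℤ) : Prop where
  q_rec : ∀ i, q (i + 2) = a i * q (i + 1) + q i
  p_rec : ∀ i, p (i + 2) = a i * p (i + 1) + p i
  one_le : ∀ i, 1 ≤ a i
  q_zero_nonneg : 0 ≤ q 0
  q_one_pos : 0 < q 1
  det_zero : q 0 * p 1 - q 1 * p 0 = 1
  err_pos : ∀ i, 0 < err x q p i
  err_lt : ∀ i, err x q p (i + 1) < err x q p i
  err_zero_le : err x q p 0 ≤ 1

namespace IsConvergentSeq

variable {x : ℝ} {a q p : ℕ → ℤ}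

theorem err_rec (S : IsConvergentSeq x a q p) (i : ℕ) :
    err x q p i = a i * err x q p (i + 1) + err x q p (i + 2) := by
  simp only [err, S.q_rec, S.p_rec, pow_succ]
  push_cast; ring

theorem det (S : IsConvergentSeq x a q p) (i : ℕ) :
    (-1) ^ i * (q i * p (i + 1) - q (i + 1) * p i) = 1 := by
  induction i with
  | zero => simpa using S.det_zero
  | succ i ih =>
    rw [S.q_rec, S.p_rec, pow_succ]
    linear_combination ih

theorem err_mul_add (S : IsConvergentSeq x a q p) (i : ℕ) :
    q (i + 1) * err x q p i + q i * err x q p (i + 1) = 1 := by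
  have h : ((-1 : ℝ)) ^ i * (q i * p (i + 1) - q (i + 1) * p i) = 1 := by
    exact_mod_cast S.det i
  simp only [err, pow_succ]
  linear_combination h

theorem q_nonneg_and_pos (S : IsConvergentSeq x a q p) (i : ℕ) : 0 ≤ q i ∧ 0 < q (i + 1) := by
  induction i with
  | zero => exact ⟨S.q_zero_nonneg, S.q_one_pos⟩
  | succ i ih =>
    refine ⟨ih.2.le, ?_⟩
    rw [S.q_rec]
    have := mul_pos (lt_of_lt_of_le one_pos (S.one_le i)) ih.2
    linarith [ih.1]

theorem q_nonneg (S : IsConvergentSeq x a q p) (i : ℕ) : 0 ≤ q i := (S.q_nonneg_and_pos i).1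

theorem q_succ_pos (S : IsConvergentSeq x a q p) (i : ℕ) : 0 < q (i + 1) :=
  (S.q_nonneg_and_pos i).2

theorem le_q_succ (S : IsConvergentSeq x a q p) (i : ℕ) : (i : ℤ) ≤ q (i + 1) := by
  induction i using Nat.twoStepInduction with
  | zero => exact (S.q_succ_pos 0).le
  | one => exact S.q_succ_pos 1
  | more i _ ih =>
    rw [S.q_rec]
    have h1 := S.q_succ_pos i
    have h2 := S.q_succ_pos (i + 1)
    have h3 := S.one_le (i + 1)
    push_cast at ih ⊢
    nlinarith

/-- Dropping the first approximation and reflecting `x` to `-x` swaps the two parities. -/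
theorem neg_shift (S : IsConvergentSeq x a q p) :
    IsConvergentSeq (-x) (fun i => a (i + 1)) (fun i => q (i + 1)) (fun i => -p (i + 1)) := by
  have e : ∀ i, err (-x) (fun i => q (i + 1)) (fun i => -p (i + 1)) i = err x q p (i + 1) := by
    intro i
    simp only [err, pow_succ]; push_cast; ring
  refine ⟨fun i => S.q_rec _, fun i => ?_, fun i => S.one_le _, S.q_nonneg 1, S.q_succ_pos 1, ?_,
    fun i => ?_, fun i => ?_, ?_⟩
  · simp only [S.p_rec (i + 1)]; ring
  · have := S.det 1
    simp only [zero_add] at this ⊢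
    linear_combination this
  · rw [e]; exact S.err_pos _
  · rw [e, e]; exact S.err_lt _
  · rw [e]; exact (S.err_lt 0).le.trans S.err_zero_le

theorem shift_two_mul (S : IsConvergentSeq x a q p) (n : ℕ) :
    IsConvergentSeq x (fun i => a (2 * n + i)) (fun i => q (2 * n + i)) (fun i => p (2 * n + i)) := by
  induction n with
  | zero => simpa using S
  | succ n ih =>
    convert ih.neg_shift.neg_shift using 2 with i i i
    · simp
    all_goals first | rw [neg_neg]; ring_nf | ring_nf

theorem isCoprime_q (S : IsConvergentSeq x a q p) (i : ℕ) : IsCoprime (q i) (q (i + 1)) :=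
  ⟨(-1) ^ i * p (i + 1), -(-1) ^ i * p i, by linear_combination S.det i⟩

end IsConvergentSeq

/-! ### Reduction of the upper bound to the error ratio -/

theorem fract_sub_eq (y : ℝ) {c : ℝ} (hc0 : 0 ≤ c) (hc1 : c < 1) :
    Int.fract (y - c) = Int.fract y - c + if Int.fract y < c then 1 else 0 := by
  have h0 := Int.fract_nonneg y
  have h1 := Int.fract_lt_one y
  have h2 := Int.self_sub_floor y
  split_ifs with h
  · exact Int.fract_eq_iff.2 ⟨by linarith, by linarith, ⌊y⌋ - 1, by push_cast; linarith⟩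
  · exact Int.fract_eq_iff.2 ⟨by linarith, by linarith, ⌊y⌋, by linarith⟩

theorem fract_add_eq (y : ℝ) {θ : ℝ} (hθ0 : 0 ≤ θ) (hθ1 : θ < 1) :
    Int.fract (y + θ) = Int.fract y + θ - if 1 - θ ≤ Int.fract y then 1 else 0 := by
  have h0 := Int.fract_nonneg y
  have h1 := Int.fract_lt_one y
  have h2 := Int.self_sub_floor y
  split_ifs with h
  · exact Int.fract_eq_iff.2 ⟨by linarith, by linarith, ⌊y⌋ + 1, by push_cast; linarith⟩
  · push Not at h
    exact Int.fract_eq_iff.2 ⟨by linarith, by linarith, ⌊y⌋, by linarith⟩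

theorem D_eq_sum_fract (x : ℝ) {c : ℝ} (hc0 : 0 ≤ c) (hc1 : c < 1) (N : ℕ) :
    D x c N = ∑ j ∈ Finset.range N,
      (Int.fract (((j + 1 : ℕ) : ℝ) * x - c) - Int.fract (((j + 1 : ℕ) : ℝ) * x)) := by
  induction N with
  | zero => simp [D_zero]
  | succ N ih => rw [D_succ, ih, Finset.sum_range_succ, fract_sub_eq _ hc0 hc1]; ring

theorem sum_sub_shift (G : ℤ → ℝ) (N M : ℕ) :
    ∑ j ∈ Finset.range N, (G (j + 1 - M) - G (j + 1)) =
      ∑ i ∈ Finset.range M, (G (-i) - G (N - i)) := by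
  induction M with
  | zero => simp
  | succ M ih =>
    rw [Finset.sum_range_succ, ← ih, ← sub_eq_iff_eq_add', ← Finset.sum_sub_distrib,
      ← neg_sub (G (N - M)) , ← neg_eq_iff_eq_neg, ← Finset.sum_neg_distrib]
    have := Finset.sum_range_sub (fun j : ℕ => G (j - M)) N
    simp only [Nat.cast_zero, zero_sub] at this
    rw [← this]
    refine Finset.sum_congr rfl fun j _ => ?_
    push_cast
    rw [show (j : ℤ) + 1 - (M + 1) = j - M by ring]
    ring

/-- If `c ≡ M x - θ` modulo `1`, then the centred indicators of `[0, c)` and of an interval of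
length `θ` add up to a coboundary, so that an upper bound for the discrepancy at `c` amounts to a lower bound for the
number of visits to `[1 - θ, 1)`. -/
theorem D_le_sub_card (x : ℝ) {c θ : ℝ} (hc0 : 0 ≤ c) (hc1 : c < 1) (hθ0 : 0 ≤ θ) (hθ1 : θ < 1)
    (M : ℕ) (z : ℤ) (hc : c = M * x - θ - z) (N : ℕ) :
    D x c N ≤ N * θ + 2 * M - ((Finset.range N).filter fun j : ℕ =>
      1 - θ ≤ Int.fract (((j + 1 : ℕ) : ℝ) * x)).card := by
  set I : ℤ → ℝ := fun i => if 1 - θ ≤ Int.fract ((i : ℝ) * x) then 1 else 0 with hI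
  set G : ℤ → ℝ := fun i => Int.fract ((i : ℝ) * x) - I i with hG
  have hG1 : ∀ i, |G i| ≤ 1 := by
    intro i
    have h0 := Int.fract_nonneg ((i : ℝ) * x)
    have h1 := Int.fract_lt_one ((i : ℝ) * x)
    rw [abs_le]
    simp only [hG, hI]
    split_ifs <;> constructor <;> linarith
  have hsum : D x c N = ∑ j ∈ Finset.range N,
      ((G (j + 1 - M) - G (j + 1)) + θ - I (j + 1)) := by
    rw [D_eq_sum_fract x hc0 hc1]
    refine Finset.sum_congr rfl fun j _ => ?_
    have e : ((j + 1 : ℕ) : ℝ) * x - c = (((j : ℤ) + 1 - M : ℤ) : ℝ) * x + θ + z := by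
      rw [hc]; push_cast; ring
    rw [e, Int.fract_add_intCast, fract_add_eq _ hθ0 hθ1]
    simp only [hG, hI]
    push_cast; ring
  have hbound : ∑ i ∈ Finset.range M, (G (-i) - G (N - i)) ≤ 2 * M := by
    calc _ ≤ ∑ i ∈ Finset.range M, (2 : ℝ) := Finset.sum_le_sum fun i _ => by
          have h1 := (abs_le.1 (hG1 (-i))).2
          have h2 := (abs_le.1 (hG1 (N - i))).1
          linarith
      _ = _ := by simp [mul_comm]
  have hcard : ∑ j ∈ Finset.range N, I (j + 1) = ((Finset.range N).filter fun j : ℕ =>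
      1 - θ ≤ Int.fract (((j + 1 : ℕ) : ℝ) * x)).card := by
    rw [Finset.card_filter, Nat.cast_sum]
    refine Finset.sum_congr rfl fun j _ => ?_
    simp [hI]
  rw [hsum, Finset.sum_sub_distrib, Finset.sum_add_distrib, sum_sub_shift, hcard]
  simp only [Finset.sum_const, Finset.card_range, nsmul_eq_mul]
  linarith

/-- Lower bound for the visits to `[1 - (s / k) δ, 1)`, where `δ = q x - p` and `p / q`, `p' / q'`
are consecutive approximations. In the unimodular coordinates `j = m q + y q'` the visits are the
pairs with `m = ⌊y β⌋` and `{y β} < s / k`, where `β` is the ratio of the errors. -/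
theorem le_card_fract_of_D_nonneg {x δ δ' : ℝ} (hx : Irrational x) {q q' : ℕ} {p p' : ℤ}
    (hδ : δ = q * x - p) (hδ' : δ' = p' - q' * x) (hδ0 : 0 < δ) (hδ1 : δ ≤ 1) (hδ'0 : 0 < δ')
    (hq' : 0 < q') (hdet : q' * δ + q * δ' = 1) {s k : ℕ} (hk : 0 < k) (hs : s ≤ k)
    (hD : ∀ Y, 0 ≤ D (δ' / δ) (s / k) Y) (N : ℕ) :
    N * (s / k * δ) - 1 ≤ ((Finset.range N).filter fun j : ℕ =>
      1 - s / k * δ ≤ Int.fract (((j + 1 : ℕ) : ℝ) * x)).card := by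
  have hkR : (0 : ℝ) < k := by exact_mod_cast hk
  have hc1 : (s : ℝ) / k ≤ 1 := by
    rw [div_le_one hkR]; exact_mod_cast hs
  have hc0 : (0 : ℝ) ≤ (s : ℝ) / k := by positivity
  set β := δ' / δ with hβ
  have hβ0 : 0 < β := div_pos hδ'0 hδ0
  have hβδ : β * δ = δ' := by rw [hβ]; field_simp
  -- By `hdet`, `j y ≤ y (β q + q') = y / δ` below, so `j y ≤ N` whenever `y ≤ N δ`.
  set Y := ⌊(N : ℝ) * δ⌋₊ with hY
  have hY1 : (Y : ℝ) ≤ N * δ := Nat.floor_le (by positivity)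
  have hY2 : (N : ℝ) * δ < Y + 1 := Nat.lt_floor_add_one _
  set j : ℕ → ℕ := fun y => ⌊(y : ℝ) * β⌋₊ * q + y * q' with hj
  have hjmono : StrictMono j := by
    refine strictMono_nat_of_lt_succ fun y => ?_
    have : ⌊(y : ℝ) * β⌋₊ ≤ ⌊((y + 1 : ℕ) : ℝ) * β⌋₊ :=
      Nat.floor_mono (by push_cast; nlinarith)
    have := Nat.mul_le_mul_right q this
    simp only [hj, add_mul]
    omega
  have hjpos : ∀ y, 1 ≤ y → 1 ≤ j y := by
    intro y hy
    have := Nat.mul_le_mul hy hq'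
    simp only [hj]; omega
  have hcard : ((Finset.Icc 1 Y).filter fun y : ℕ => Int.fract ((y : ℝ) * β) < s / k).card ≤
      ((Finset.range N).filter fun j : ℕ =>
        1 - s / k * δ ≤ Int.fract (((j + 1 : ℕ) : ℝ) * x)).card := by
    refine Finset.card_le_card_of_injOn (fun y => j y - 1) ?_ ?_
    · intro y hy
      simp only [Finset.coe_filter, Finset.mem_Icc, Set.mem_ofPred_eq, Finset.mem_range] at hy ⊢
      obtain ⟨⟨hy1, hyY⟩, hyf⟩ := hy
      have h1 := hjpos y hy1
      rw [Nat.sub_add_cancel h1]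
      have hfl : ((⌊(y : ℝ) * β⌋₊ : ℕ) : ℝ) = y * β - Int.fract (y * β) := by
        rw [Int.self_sub_fract, natCast_floor_eq_intCast_floor (by positivity)]
      have hjx : (j y : ℝ) * x
          = -(δ * Int.fract (y * β)) + ((⌊(y : ℝ) * β⌋₊ * p + y * p' : ℤ) : ℝ) := by
        simp only [hj]; push_cast
        rw [hfl]
        linear_combination (-(y * β - Int.fract (y * β))) * hδ + (y : ℝ) * hδ' + (y : ℝ) * hβδ
      have hf0 : 0 < Int.fract ((y : ℝ) * β) := by
        refine lt_of_le_of_ne (Int.fract_nonneg _) fun h0 => ?_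
        rw [← h0, mul_zero, neg_zero, zero_add] at hjx
        exact (hx.natCast_mul (by omega : j y ≠ 0)).ne_int _ hjx
      have hf1 := Int.fract_lt_one ((y : ℝ) * β)
      constructor
      · have : (j y : ℝ) ≤ N := by
          have h2 : (j y : ℝ) * δ ≤ y := by
            simp only [hj]; push_cast
            rw [hfl]
            have : 0 ≤ Int.fract ((y : ℝ) * β) * q * δ := by positivity
            have e : (y : ℝ) = y * (q' * δ + q * δ') := by rw [hdet, mul_one]
            rw [← hβδ] at e
            nlinarith
          have h3 : (y : ℝ) ≤ Y := by exact_mod_cast hyY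
          exact le_of_mul_le_mul_right (h2.trans (h3.trans hY1)) hδ0
        have : j y ≤ N := by exact_mod_cast this
        omega
      · have e : Int.fract ((j y : ℝ) * x) = 1 - δ * Int.fract (y * β) := by
          rw [hjx, Int.fract_add_intCast, Int.fract_eq_iff]
          exact ⟨by nlinarith, by nlinarith, -1, by push_cast; ring⟩
        rw [e]
        nlinarith
    · intro y hy y' hy' h
      simp only [Finset.coe_filter, Finset.mem_Icc, Set.mem_ofPred_eq] at hy hy' h
      have h1 := hjpos y hy.1.1
      have h2 := hjpos y' hy'.1.1
      exact hjmono.injective (by omega)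
  have hDY := hD Y
  rw [D_eq_card] at hDY
  have hcardR := Nat.cast_le (α := ℝ).2 hcard
  nlinarith

/-- The step between divisibility of denominators and divisibility of partial quotients. -/
theorem dvd_iff_dvd_of_isCoprime {k q₀ q₁ q₂ a : ℤ} (hcop : IsCoprime q₀ q₁)
    (h : q₂ = a * q₁ + q₀) (h₀ : k ∣ q₀) : k ∣ q₂ ↔ k ∣ a := by
  rw [h, dvd_add_left h₀]
  exact ⟨fun h => (hcop.of_isCoprime_of_dvd_left h₀).dvd_of_dvd_mul_right h,
    fun h => h.mul_right _⟩

/-- Divisibility of the denominators of all approximations from below suffices for an upper bound: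
the case where the divisibility starts at index `0`. -/
theorem bddAbove_D_of_forall_dvd {x : ℝ} {a q p : ℕ → ℤ} (S : IsConvergentSeq x a q p)
    (hx : Irrational x) {h k : ℕ} (h_pos : 0 < h) (h_lt : h < k)
    (hdvd : ∀ n, (k : ℤ) ∣ q (2 * n)) : BddAbove (Set.range (D x (h / k))) := by
  have hk : 0 < k := h_pos.trans h_lt
  have hkR : (0 : ℝ) < k := by exact_mod_cast hk
  have hkZ : (0 : ℤ) < k := by exact_mod_cast hk
  have hq0 := hdvd 0
  rw [Nat.mul_zero] at hq0
  have hde := S.det_zero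
  -- `s ≡ -h q₁ ≡ h / p₀` modulo `k`, so that `c ≡ s p₀ / k`.
  obtain ⟨s, hs⟩ : ∃ s : ℕ, (s : ℤ) = (-h * q 1) % k :=
    ⟨_, Int.toNat_of_nonneg (Int.emod_nonneg _ hkZ.ne')⟩
  have hslt : s < k := by
    have := Int.emod_lt_of_pos (-h * q 1) hkZ
    rw [← hs] at this; exact_mod_cast this
  obtain ⟨w, hw⟩ := hq0
  obtain ⟨z, hz⟩ : ∃ z : ℤ, s * p 0 - h = k * z := by
    have e := Int.emod_add_mul_ediv (-h * q 1) k
    rw [← hs] at e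
    exact ⟨-h * w * p 1 - (-h * q 1) / k * p 0, by
      linear_combination p 0 * e + h * hde - h * p 1 * hw⟩
  have hs0 : 0 < s := by
    rcases Nat.eq_zero_or_pos s with h0 | h0
    · exfalso
      rw [h0] at hz
      have : (k : ℤ) ∣ h := ⟨-z, by push_cast at hz; linear_combination -hz⟩
      have := Nat.le_of_dvd h_pos (Int.natCast_dvd_natCast.1 this)
      omega
    · exact h0
  have hw0 : 0 ≤ w := by
    by_contra! hneg
    have := S.q_zero_nonneg
    rw [hw] at this
    nlinarith
  obtain ⟨W, rfl⟩ := Int.eq_ofNat_of_zero_le hw0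
  obtain ⟨q₁, hq₁⟩ := Int.eq_ofNat_of_zero_le S.q_one_pos.le
  have hq₁' : 0 < q₁ := by have := S.q_one_pos; rw [hq₁] at this; exact_mod_cast this
  set δ := err x q p with hδ
  have e0 : δ 0 = (k * W : ℕ) * x - p 0 := by simp [hδ, err, hw]
  have e1 : δ 1 = p 1 - q₁ * x := by simp [hδ, err, hq₁]
  have hsk : (s : ℝ) / k < 1 := by rw [div_lt_one hkR]; exact_mod_cast hslt
  have hsk0 : (0 : ℝ) < s / k := by positivity
  have hpos := S.err_pos
  have ha : ∀ i, ((a i).toNat : ℝ) = a i := fun i => by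
    exact_mod_cast Int.toNat_of_nonneg (zero_le_one.trans (S.one_le i))
  have hD : ∀ Y, 0 ≤ D (δ 1 / δ 0) (s / k) Y := fun Y =>
    D_nonneg hk hs0 hslt.le Y (fun i => δ (i + 1) / δ i) (fun i => (a i).toNat)
      (fun i => div_pos (hpos _) (hpos _))
      (fun i => by rw [div_lt_one (hpos _)]; exact S.err_lt i)
      (fun i => by
        have h1 := (hpos i).ne'
        have h2 := (hpos (i + 1)).ne'
        rw [ha]
        change err x q p (i + 1) / err x q p i *
          (a i + err x q p (i + 1 + 1) / err x q p (i + 1)) = 1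
        field_simp
        linear_combination -(S.err_rec i))
      (fun i => by
        have := (dvd_iff_dvd_of_isCoprime (S.isCoprime_q (2 * i)) (S.q_rec _) (hdvd i)).1
          (hdvd (i + 1))
        rw [← Int.toNat_of_nonneg (zero_le_one.trans (S.one_le (2 * i)))] at this
        exact_mod_cast this)
  refine ⟨2 * ((s * W : ℕ) : ℝ) + 1, ?_⟩
  rintro _ ⟨N, rfl⟩
  have h1 := D_le_sub_card x (c := h / k) (θ := s / k * δ 0) (by positivity)
    (by rw [div_lt_one hkR]; exact_mod_cast h_lt) (mul_pos hsk0 (hpos 0)).le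
    (by nlinarith [hpos 0, S.err_zero_le]) (s * W) z (by
      have hz' : (s : ℝ) * p 0 - h = k * z := by exact_mod_cast hz
      rw [e0]; push_cast
      field_simp
      linear_combination -hz') N
  have h2 := le_card_fract_of_D_nonneg hx e0 e1 (hpos 0) S.err_zero_le (hpos 1) hq₁'
    (by have := S.err_mul_add 0
        rw [zero_add, hq₁, hw] at this; push_cast at this ⊢; exact this) hk hslt.le hD N
  linarith

/-! ### The descent forced by an upper bound -/

theorem D_add_eq_of_small (x : ℝ) {c : ℝ} (hc : c < 1) (N : ℕ) :
    ∃ ε > 0, ∀ (Q : ℕ) (P : ℤ), 0 ≤ Q * x - P → Q * x - P < ε →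
      D x c (Q + N) = D x c Q + D x c N := by
  induction N with
  | zero => exact ⟨1, one_pos, fun Q P _ _ => by simp [D_zero]⟩
  | succ N ih =>
    obtain ⟨ε, hε, H⟩ := ih
    set f := Int.fract (((N + 1 : ℕ) : ℝ) * x) with hf
    have hf0 : 0 ≤ f := Int.fract_nonneg _
    have hf1 : f < 1 := Int.fract_lt_one _
    -- `[0, c)` is open on the right, so a small shift to the right changes no membership.
    have key : ∃ ε' > 0, ∀ (Q : ℕ) (P : ℤ), 0 ≤ Q * x - P → Q * x - P < ε' →
        (Int.fract (((Q + N + 1 : ℕ) : ℝ) * x) < c ↔ f < c) := by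
      have e : ∀ (Q : ℕ) (P : ℤ), 0 ≤ Q * x - P → Q * x - P < 1 - f →
          Int.fract (((Q + N + 1 : ℕ) : ℝ) * x) = f + (Q * x - P) := by
        intro Q P h0 h1
        rw [Int.fract_eq_iff]
        refine ⟨by linarith, by linarith, ⌊((N + 1 : ℕ) : ℝ) * x⌋ + P, ?_⟩
        rw [hf]
        have := Int.self_sub_floor (((N + 1 : ℕ) : ℝ) * x)
        push_cast at this ⊢
        linarith
      by_cases hfc : f < c
      · refine ⟨c - f, by linarith, fun Q P h0 h1 => ?_⟩
        rw [e Q P h0 (by linarith)]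
        exact ⟨fun _ => hfc, fun _ => by linarith⟩
      · refine ⟨1 - f, by linarith, fun Q P h0 h1 => ?_⟩
        rw [e Q P h0 h1]
        exact ⟨fun _ => by linarith, fun h => absurd h hfc⟩
    obtain ⟨ε', hε', H'⟩ := key
    refine ⟨min ε ε', lt_min hε hε', fun Q P h0 h1 => ?_⟩
    rw [← add_assoc, D_succ, H Q P h0 (h1.trans_le (min_le_left _ _)), D_succ x c N]
    simp only [H' Q P h0 (h1.trans_le (min_le_right _ _))]
    rw [hf]; ring

/-- Return times with positive discrepancy that come arbitrarily close to `0` from the right can be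
concatenated, and the discrepancies add up. -/
theorem not_bddAbove_D {x : ℝ} {h k : ℕ} (h_lt : h < k)
    (H : ∀ ε > 0, ∃ (Q : ℕ) (P : ℤ), 0 ≤ Q * x - P ∧ Q * x - P < ε ∧ 0 < D x (h / k) Q) :
    ¬ BddAbove (Set.range (D x (h / k))) := by
  have hk : (0 : ℝ) < k := by exact_mod_cast (Nat.zero_le _).trans_lt h_lt
  have step : ∀ Q, 0 < D x (h / k) Q → 1 / k ≤ D x (h / k) Q := by
    intro Q hQ
    rw [D_eq_card] at hQ ⊢
    set C := ((Finset.Icc 1 Q).filter fun j : ℕ => Int.fract ((j : ℝ) * x) < h / k).card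
    have e : (C : ℝ) - Q * (h / k) = ((C * k - Q * h : ℤ) : ℝ) / k := by
      push_cast; field_simp
    rw [e] at hQ ⊢
    have h1 : (0 : ℝ) < ((C * k - Q * h : ℤ) : ℝ) := (div_pos_iff_of_pos_right hk).1 hQ
    have h2 : (1 : ℤ) ≤ C * k - Q * h := by exact_mod_cast h1
    rw [div_le_div_iff_of_pos_right hk]
    exact_mod_cast h2
  have grow : ∀ T : ℕ, ∃ N, T / k ≤ D x (h / k) N := by
    intro T
    induction T with
    | zero => exact ⟨0, by simp [D_zero]⟩
    | succ T ih =>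
      obtain ⟨N, hN⟩ := ih
      obtain ⟨ε, hε, hadd⟩ := D_add_eq_of_small x (c := h / k)
        (by rw [div_lt_one hk]; exact_mod_cast h_lt) N
      obtain ⟨Q, P, h0, h1, hQ⟩ := H ε hε
      refine ⟨Q + N, ?_⟩
      rw [hadd Q P h0 h1]
      have := step Q hQ
      push_cast
      rw [add_div]
      linarith
  rintro ⟨B, hB⟩
  obtain ⟨T, hT⟩ := exists_nat_gt (B * k)
  obtain ⟨N, hN⟩ := grow T
  have := hB ⟨N, rfl⟩
  have h2 : B < T / k := by rwa [lt_div_iff₀ hk]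
  linarith

/-- If the discrepancy at a denominator `Q` of an approximation from below is not positive, then
one of the `⌊c Q⌋ + 1` points with `j P mod Q ≤ ⌊c Q⌋` has been carried past `c` by its drift
`j δ / Q`, so `j x` approximates `c` from the right. -/
theorem exists_fract_near_of_D_nonpos {x δ : ℝ} {h k Q : ℕ} {P Q' P' : ℤ} (h_lt : h < k)
    (hQ : 0 < Q) (hδ : δ = Q * x - P) (hδ0 : 0 < δ) (hQδ : Q * δ < 1)
    (hdet : Q * P' - Q' * P = 1) (hndvd : ¬ k ∣ h * Q) (hD : D x (h / k) Q ≤ 0) :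
    ∃ j : ℕ, 1 ≤ j ∧ j ≤ Q ∧ ∃ z : ℤ, 0 ≤ j * x - h / k - z ∧ (j * x - h / k - z) * Q < j * δ := by
  by_contra! hcon
  have hk : 0 < k := (Nat.zero_le _).trans_lt h_lt
  have hkR : (0 : ℝ) < k := by exact_mod_cast hk
  have hQR : (0 : ℝ) < Q := by exact_mod_cast hQ
  have hQZ : (0 : ℤ) < Q := by exact_mod_cast hQ
  set R := h * Q / k with hR
  have hR1 : R * k < h * Q := by
    refine lt_of_le_of_ne (Nat.div_mul_le_self _ _) fun e => hndvd ⟨R, ?_⟩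
    rw [← e, mul_comm]
  have hR2 : h * Q < (R + 1) * k := by
    rw [mul_comm (R + 1)]; exact Nat.lt_mul_div_succ _ hk
  have hRQ : R < Q := by
    rw [hR, Nat.div_lt_iff_lt_mul hk, mul_comm]
    exact Nat.mul_lt_mul_of_pos_left h_lt hQ
  -- For every residue `r` the time `j` with `j P ≡ r`.
  have time : ∀ r : ℕ, ∃ j : ℕ, 1 ≤ j ∧ j ≤ Q ∧ ∃ z : ℤ, j * P = r + Q * z := by
    intro r
    have h0 := Int.emod_nonneg (-Q' * r - 1) hQZ.ne'
    have h1 := Int.emod_lt_of_pos (-Q' * r - 1) hQZ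
    have h2 := Int.emod_add_mul_ediv (-Q' * r - 1) Q
    refine ⟨((-Q' * r - 1) % Q).toNat + 1, by omega, by omega,
      -r * P' - ((-Q' * r - 1) / Q) * P, ?_⟩
    push_cast
    rw [Int.toNat_of_nonneg h0]
    linear_combination P * h2 + r * hdet
  choose j hj1 hjQ z hz using time
  have hcard : R + 1 ≤
      ((Finset.Icc 1 Q).filter fun j : ℕ => Int.fract ((j : ℝ) * x) < h / k).card := by
    rw [← Finset.card_range (R + 1)]
    refine Finset.card_le_card_of_injOn j ?_ ?_
    · intro r hr
      simp only [Finset.coe_range, Set.mem_Iio, Finset.coe_filter, Finset.mem_Icc,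
        Set.mem_ofPred_eq] at hr ⊢
      refine ⟨⟨hj1 r, hjQ r⟩, ?_⟩
      have hzR : (j r : ℝ) * P = r + Q * z r := by exact_mod_cast hz r
      have e : ((j r : ℝ) * x - z r) * Q = r + j r * δ := by
        rw [hδ]; linear_combination hzR
      have hjR : (j r : ℝ) ≤ Q := by exact_mod_cast hjQ r
      have hj0 : (0 : ℝ) < j r := by exact_mod_cast hj1 r
      have hrQ : (r : ℝ) + 1 ≤ Q := by exact_mod_cast (by omega : r + 1 ≤ Q)
      have hfr : Int.fract ((j r : ℝ) * x) = j r * x - z r := by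
        rw [Int.fract_eq_iff]
        refine ⟨?_, ?_, z r, by ring⟩
        · refine le_of_mul_le_mul_right ?_ hQR
          rw [e, zero_mul]; positivity
        · refine lt_of_mul_lt_mul_right ?_ hQR.le
          rw [e]; nlinarith
      rw [hfr]
      by_contra! hge
      have := hcon (j r) (hj1 r) (hjQ r) (z r) (by linarith)
      have hrR : (r : ℝ) * k < h * Q := by
        have : r * k ≤ R * k := Nat.mul_le_mul_right k (by omega)
        exact_mod_cast this.trans_lt hR1
      have hrR' : (r : ℝ) < h / k * Q := by
        rw [div_mul_eq_mul_div, lt_div_iff₀ hkR]; exact hrR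
      nlinarith
    · intro r hr r' hr' hrr
      simp only [Finset.coe_range, Set.mem_Iio] at hr hr'
      have e : (r : ℤ) - r' = Q * (z r' - z r) := by
        have h1 := hz r
        have h2 := hz r'
        rw [hrr] at h1
        linear_combination h2 - h1
      have : (r : ℤ) - r' = 0 := Int.eq_zero_of_abs_lt_dvd ⟨_, e⟩ (by rw [abs_lt]; omega)
      omega
  rw [D_eq_card] at hD
  have hcR : ((R + 1 : ℕ) : ℝ) ≤ _ := Nat.cast_le (α := ℝ).2 hcard
  have : (Q : ℝ) * (h / k) < (R + 1 : ℕ) := by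
    rw [← mul_div_assoc, div_lt_iff₀ hkR, mul_comm]; exact_mod_cast hR2
  linarith

/-- The descent behind the necessity of the divisibility condition: with `p' / q'`, `P / Q` and
`q'' = a Q + q'` consecutive denominators, non-positive discrepancy at `Q` with `k ∤ Q` makes the
residue of `-h q'` modulo `k` drop when `q'` is replaced by `q''`. -/
theorem emod_lt_emod_of_D_nonpos {x δ δ' δ'' : ℝ} {h k Q : ℕ} {P Q' P' a : ℤ} (h_lt : h < k)
    (hQ : 0 < Q) (hQ' : 0 < Q') (hδ : δ = Q * x - P) (hδ' : δ' = P' - Q' * x) (hδ0 : 0 < δ)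
    (hδ'0 : 0 < δ') (hδ''0 : 0 < δ'') (hrec : δ' = a * δ + δ'') (ha : 1 ≤ a) (hQδ : Q * δ < 1)
    (hdet : Q * P' - Q' * P = 1) (hndvd : ¬ k ∣ h * Q) (hD : D x (h / k) Q ≤ 0) :
    (-h * (a * Q + Q')) % k < (-h * Q') % (k : ℤ) := by
  obtain ⟨j, hj1, hjQ, z, hθ0, hθ⟩ :=
    exists_fract_near_of_D_nonpos h_lt hQ hδ hδ0 hQδ hdet hndvd hD
  have hk : 0 < k := (Nat.zero_le _).trans_lt h_lt
  have hkR : (0 : ℝ) < k := by exact_mod_cast hk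
  have hQR : (0 : ℝ) < Q := by exact_mod_cast hQ
  have hQZ : (0 : ℤ) < Q := by exact_mod_cast hQ
  have hQ'R : (0 : ℝ) < Q' := by exact_mod_cast hQ'
  have hkZ : (0 : ℤ) < k := by exact_mod_cast hk
  -- `(k j, h + k z) = U (Q, P) + V (Q', P')`.
  obtain ⟨U, hU⟩ : ∃ U : ℤ, U = k * j * P' - Q' * (h + k * z) := ⟨_, rfl⟩
  obtain ⟨V, hV⟩ : ∃ V : ℤ, V = Q * (h + k * z) - P * (k * j) := ⟨_, rfl⟩
  have hUV : U * Q + V * Q' = k * j := by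
    rw [hU, hV]; linear_combination (k * j : ℤ) * hdet
  have hUVR : (U : ℝ) * Q + V * Q' = k * j := by exact_mod_cast hUV
  have hdetR : (Q : ℝ) * P' - Q' * P = 1 := by exact_mod_cast hdet
  have herr : U * δ - V * δ' = k * (j * x - h / k - z) := by
    rw [hU, hV, hδ, hδ']; push_cast
    field_simp
    linear_combination (k * j * x - h - k * z : ℝ) * hdetR
  -- The error of `j x` is smaller than the drift `j δ / Q`, which forces `V > 0`.
  have hVpos : 0 < V := by
    have h1 : (U * δ - V * δ') * Q < (U * Q + V * Q') * δ := by
      rw [herr, hUVR]; nlinarith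
    have h2 : (0 : ℝ) < V * (Q' * δ + Q * δ') := by linarith
    have h3 : (0 : ℝ) < V := pos_of_mul_pos_left h2 (by positivity)
    exact_mod_cast h3
  have hVR : (0 : ℝ) < V := by exact_mod_cast hVpos
  -- Substituting `δ' = a δ + δ''` in `V δ' ≤ U δ` shows that the next residue is `U - a V`,
  -- without reduction modulo `k`.
  have hW : 0 < U - a * V := by
    have h1 : 0 ≤ U * δ - V * δ' := by rw [herr]; positivity
    have h2 : (0 : ℝ) < (U - a * V) * δ := by
      rw [hrec] at h1
      have := mul_pos hVR hδ''0
      linarith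
    have h3 : (0 : ℝ) < U - a * V := pos_of_mul_pos_left h2 hδ0.le
    exact_mod_cast h3
  have haV : 0 < a * V := mul_pos (by omega) hVpos
  have hUk : U < k := by
    have h1 : U * Q < k * Q := by
      have h2 : (k : ℤ) * j ≤ k * Q := by gcongr
      have := mul_pos hVpos hQ'
      linarith
    exact lt_of_mul_lt_mul_right h1 hQZ.le
  have e1 : (-h * Q') % (k : ℤ) = U := by
    rw [show -h * Q' = U + k * (Q' * z - j * P') by rw [hU]; ring, Int.add_mul_emod_self_left,
      Int.emod_eq_of_lt (by omega) hUk]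
  have e2 : (-h * (a * Q + Q')) % (k : ℤ) = U - a * V := by
    rw [show -h * (a * Q + Q') = U - a * V + k * (Q' * z - j * P' + a * (Q * z - P * j)) by
      rw [hU, hV]; ring, Int.add_mul_emod_self_left, Int.emod_eq_of_lt hW.le (by omega)]
  rw [e1, e2]
  omega

theorem exists_forall_ge_eq_of_antitone {v : ℕ → ℕ} (hv : Antitone v) :
    ∃ n, ∀ m, n ≤ m → v m = v n := by
  obtain ⟨_, ⟨n, rfl⟩, hn⟩ := wellFounded_lt.has_min (Set.range v) ⟨_, 0, rfl⟩
  exact ⟨n, fun m hm => le_antisymm (hv hm) (not_lt.1 (hn _ ⟨m, rfl⟩))⟩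

/-- An upper bound forces divisibility: the residues of `-h q_{i-1}` modulo `k` for even `i`
eventually form a non-increasing sequence of non-negative integers that drops when `k ∤ q_i`. -/
theorem exists_forall_dvd_of_bddAbove_D {x : ℝ} {a q p : ℕ → ℤ} (S : IsConvergentSeq x a q p)
    {h k : ℕ} (h_lt : h < k) (hcop : Nat.Coprime h k)
    (hB : BddAbove (Set.range (D x (h / k)))) : ∃ m, ∀ n, (k : ℤ) ∣ q (2 * (m + n)) := by
  have hkZ : (0 : ℤ) < k := by exact_mod_cast (Nat.zero_le _).trans_lt h_lt
  set Q : ℕ → ℕ := fun n => (q (2 * n + 2)).toNat with hQdef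
  have hQ : ∀ n, (Q n : ℤ) = q (2 * n + 2) := fun n => Int.toNat_of_nonneg (S.q_nonneg _)
  have hQR : ∀ n, (Q n : ℝ) = q (2 * n + 2) := fun n => by exact_mod_cast hQ n
  have herr : ∀ n, err x q p (2 * n + 2) = Q n * x - p (2 * n + 2) := by
    intro n
    rw [err, hQR, Even.neg_one_pow ⟨n + 1, by ring⟩, one_mul]
  have herr' : ∀ n, err x q p (2 * n + 1) = p (2 * n + 1) - q (2 * n + 1) * x := by
    intro n
    rw [err, Odd.neg_one_pow ⟨n, rfl⟩]; ring
  have nonpos : ∃ n₀, ∀ n, n₀ ≤ n → D x (h / k) (Q n) ≤ 0 := by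
    by_contra! hcon
    refine not_bddAbove_D h_lt (fun ε hε => ?_) hB
    obtain ⟨n₀, hn₀⟩ := exists_nat_gt (1 / ε)
    obtain ⟨n, hn, hpos⟩ := hcon n₀
    refine ⟨Q n, p (2 * n + 2), ?_, ?_, hpos⟩
    · rw [← herr]; exact (S.err_pos _).le
    · rw [← herr]
      have h1 := S.err_mul_add (2 * n + 2)
      have h2 : ((2 * n + 2 : ℕ) : ℝ) ≤ q (2 * n + 2 + 1) := by exact_mod_cast S.le_q_succ _
      have h3 : (0 : ℝ) ≤ q (2 * n + 2) := by exact_mod_cast S.q_nonneg _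
      have h4 := mul_nonneg h3 (S.err_pos (2 * n + 2 + 1)).le
      have h5 : (n₀ : ℝ) ≤ n := by exact_mod_cast hn
      have h6 : 1 / ε < q (2 * n + 2 + 1) := by push_cast at h2; linarith
      rw [div_lt_iff₀ hε] at h6
      have h7 : (0 : ℝ) < q (2 * n + 2 + 1) := by exact_mod_cast S.q_succ_pos _
      nlinarith
  obtain ⟨n₀, hn₀⟩ := nonpos
  set u : ℕ → ℤ := fun n => (-h * q (2 * n + 1)) % k with hu
  have drop : ∀ n, n₀ ≤ n → ¬ (k : ℤ) ∣ q (2 * n + 2) → u (n + 1) < u n := by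
    intro n hn hnd
    have hQpos : 0 < Q n := by
      have hpos : 0 < q (2 * n + 2) := S.q_succ_pos _
      rw [← hQ] at hpos
      exact_mod_cast hpos
    have := emod_lt_emod_of_D_nonpos (a := a (2 * n + 1)) (P := p (2 * n + 2)) h_lt hQpos
      (S.q_succ_pos (2 * n)) (herr n) (herr' n) (S.err_pos _) (S.err_pos _) (S.err_pos _)
      (S.err_rec _) (S.one_le _) ?_ ?_ ?_ (hn₀ n hn)
    · simp only [hu]
      rwa [show 2 * (n + 1) + 1 = 2 * n + 1 + 2 by ring, S.q_rec, ← hQ]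
    · rw [hQR]
      have h1 := S.err_mul_add (2 * n + 2)
      have h2 : (q (2 * n + 2) : ℝ) ≤ q (2 * n + 2 + 1) := by
        have h3 := S.q_succ_pos (2 * n + 1)
        have h4 := S.q_succ_pos (2 * n)
        have h5 := S.one_le (2 * n + 1)
        have h6 : q (2 * n + 2) ≤ q (2 * n + 2 + 1) := by
          rw [S.q_rec (2 * n + 1)]; nlinarith
        exact_mod_cast h6
      have h3 : (0 : ℝ) < q (2 * n + 2) := by exact_mod_cast S.q_succ_pos (2 * n + 1)
      have h4 := mul_pos h3 (S.err_pos (2 * n + 2 + 1))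
      have h5 := mul_le_mul_of_nonneg_right h2 (S.err_pos (2 * n + 2)).le
      linarith
    · have := S.det (2 * n + 1)
      rw [Odd.neg_one_pow ⟨n, rfl⟩] at this
      rw [hQ]
      linear_combination this
    · intro hd
      refine hnd ?_
      rw [← hQ]
      exact_mod_cast (Nat.Coprime.dvd_of_dvd_mul_left hcop.symm hd)
  have stay : ∀ n, (k : ℤ) ∣ q (2 * n + 2) → u (n + 1) = u n := by
    intro n hd
    obtain ⟨w, hw⟩ := hd
    simp only [hu]
    rw [show 2 * (n + 1) + 1 = 2 * n + 1 + 2 by ring, S.q_rec, hw,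
      show -h * (a (2 * n + 1) * (k * w) + q (2 * n + 1))
        = -h * q (2 * n + 1) + k * (-h * a (2 * n + 1) * w) by ring, Int.add_mul_emod_self_left]
  have hu0 : ∀ n, 0 ≤ u n := fun n => Int.emod_nonneg _ hkZ.ne'
  obtain ⟨n₁, hn₁⟩ := exists_forall_ge_eq_of_antitone (v := fun n => (u (n₀ + n)).toNat)
    (antitone_nat_of_succ_le fun n => by
      by_cases hd : (k : ℤ) ∣ q (2 * (n₀ + n) + 2)
      · rw [← add_assoc, stay _ hd]
      · exact Int.toNat_le_toNat (drop (n₀ + n) (by omega) hd).le)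
  refine ⟨n₀ + n₁ + 1, fun n => ?_⟩
  by_contra hnd
  have h1 := drop (n₀ + n₁ + n) (by omega) (by
    rwa [show 2 * (n₀ + n₁ + 1 + n) = 2 * (n₀ + n₁ + n) + 2 by ring] at hnd)
  have h2 := hn₁ (n₁ + n) (by omega)
  have h3 := hn₁ (n₁ + n + 1) (by omega)
  simp only [← add_assoc] at h2 h3
  have h4 := hu0 (n₀ + n₁ + n)
  have h5 := hu0 (n₀ + n₁ + n + 1)
  omega

/-- The discrepancy of `(jx)` at `h / k` is bounded above exactly when `k` divides eventually all
denominators of the approximations to `x` from below. -/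
theorem bddAbove_D_iff {x : ℝ} {a q p : ℕ → ℤ} (S : IsConvergentSeq x a q p)
    (hx : Irrational x) {h k : ℕ} (h_pos : 0 < h) (h_lt : h < k) (hcop : Nat.Coprime h k) :
    BddAbove (Set.range (D x (h / k))) ↔ ∃ m, ∀ n, (k : ℤ) ∣ q (2 * (m + n)) := by
  refine ⟨exists_forall_dvd_of_bddAbove_D S h_lt hcop, fun ⟨m, hm⟩ => ?_⟩
  refine bddAbove_D_of_forall_dvd (S.shift_two_mul m) hx h_pos h_lt fun n => ?_
  rw [← mul_add]; exact hm n

/-! ### Convergents of the continued fraction -/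

/-- The numerators attached to `(a_n)`, with the same shift of the index as in `shiftedDen`:
`shiftedNum a i` is `p_{i-2}`, where `p_{-2} = 0` and `p_{-1} = 1`. -/
def shiftedNum (a : ℕ → ℤ) : ℕ → ℤ
  | 0 => 0
  | 1 => 1
  | n + 2 => a n * shiftedNum a (n + 1) + shiftedNum a n

/-- The `n`-th fractional part produced by the continued fraction algorithm. -/
noncomputable def remainder (α : ℝ) : ℕ → ℝ
  | 0 => Int.fract α
  | n + 1 => Int.fract (remainder α n)⁻¹

theorem irrational_fract {y : ℝ} (hy : Irrational y) : Irrational (Int.fract y) :=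
  hy.sub_intCast _

theorem irrational_remainder {α : ℝ} (hα : Irrational α) (n : ℕ) :
    Irrational (remainder α n) := by
  induction n with
  | zero => exact irrational_fract hα
  | succ n ih => exact irrational_fract ih.inv

theorem remainder_pos {α : ℝ} (hα : Irrational α) (n : ℕ) : 0 < remainder α n := by
  refine lt_of_le_of_ne ?_ (irrational_remainder hα n).ne_zero.symm
  cases n <;> exact Int.fract_nonneg _

theorem remainder_lt_one (α : ℝ) (n : ℕ) : remainder α n < 1 := by
  cases n <;> exact Int.fract_lt_one _

theorem stream_fr_eq_remainder {α : ℝ} (hα : Irrational α) (n : ℕ) :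
    ∃ b, GenContFract.IntFractPair.stream α n = some ⟨b, remainder α n⟩ := by
  induction n with
  | zero => exact ⟨⌊α⌋, rfl⟩
  | succ n ih =>
    obtain ⟨b, hb⟩ := ih
    exact ⟨⌊(remainder α n)⁻¹⌋,
      GenContFract.IntFractPair.stream_succ_of_some hb (remainder_pos hα n).ne'⟩

theorem partialQuotient_zero (α : ℝ) : partialQuotient α 0 = ⌊α⌋ := rfl

theorem partialQuotient_succ {α : ℝ} (hα : Irrational α) (n : ℕ) :
    partialQuotient α (n + 1) = ⌊(remainder α n)⁻¹⌋ := by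
  obtain ⟨b, hb⟩ := stream_fr_eq_remainder hα n
  rw [partialQuotient,
    GenContFract.IntFractPair.stream_succ_of_some hb (remainder_pos hα n).ne']
  rfl

theorem isConvergentSeq_neg {α : ℝ} (hα : Irrational α) :
    IsConvergentSeq (-α) (fun i => partialQuotient α (i + 1))
      (fun i => shiftedDen (partialQuotient α) (i + 1))
      (fun i => -shiftedNum (partialQuotient α) (i + 1)) := by
  set a := partialQuotient α with ha
  set q : ℕ → ℤ := fun i => shiftedDen a (i + 1) with hq
  set p : ℕ → ℤ := fun i => -shiftedNum a (i + 1) with hp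
  have q0 : q 0 = 0 := rfl
  have q1 : q 1 = 1 := by simp [hq, shiftedDen]
  have p0 : p 0 = -1 := rfl
  have p1 : p 1 = -a 0 := by simp [hp, shiftedNum]
  have q_rec : ∀ i, q (i + 2) = a (i + 1) * q (i + 1) + q i := fun i => rfl
  have p_rec : ∀ i, p (i + 2) = a (i + 1) * p (i + 1) + p i := fun i => by
    simp only [hp]; rw [shiftedNum]; ring
  have rec_inv : ∀ i, (remainder α i)⁻¹ = a (i + 1) + remainder α (i + 1) := fun i => by
    rw [ha, partialQuotient_succ hα, remainder, Int.floor_add_fract]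
  have err_zero : err (-α) q p 0 = 1 := by simp [err, q0, p0]
  -- The ratio of consecutive errors is the remainder of the continued fraction algorithm.
  have err_succ : ∀ i, err (-α) q p (i + 1) = remainder α i * err (-α) q p i := by
    intro i
    induction i with
    | zero =>
      rw [err_zero, zero_add, err, q1, p1, ha, partialQuotient_zero, remainder]
      have := Int.self_sub_floor α
      push_cast; linarith
    | succ i ih =>
      have h1 : err (-α) q p i = a (i + 1) * err (-α) q p (i + 1) + err (-α) q p (i + 2) := by
        simp only [err, q_rec, p_rec, pow_succ]; push_cast; ring
      have h2 := (remainder_pos hα i).ne'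
      have h3 : err (-α) q p i = (remainder α i)⁻¹ * err (-α) q p (i + 1) := by
        rw [ih]; field_simp
      rw [rec_inv] at h3
      linear_combination h3 - h1
  have err_pos : ∀ i, 0 < err (-α) q p i := by
    intro i
    induction i with
    | zero => rw [err_zero]; exact one_pos
    | succ i ih => rw [err_succ]; exact mul_pos (remainder_pos hα i) ih
  refine ⟨q_rec, p_rec, fun i => ?_, q0.ge, by rw [q1]; exact one_pos, by simp [q0, q1, p0],
    err_pos, fun i => ?_, err_zero.le⟩
  · rw [ha, partialQuotient_succ hα, Int.le_floor, Int.cast_one,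
      one_le_inv₀ (remainder_pos hα i)]
    exact (remainder_lt_one α i).le
  · rw [err_succ]
    have := mul_lt_mul_of_pos_right (remainder_lt_one α i) (err_pos i)
    rwa [one_mul] at this

theorem isConvergentSeq {α : ℝ} (hα : Irrational α) :
    IsConvergentSeq α (fun i => partialQuotient α (i + 2))
      (fun i => shiftedDen (partialQuotient α) (i + 2))
      (fun i => shiftedNum (partialQuotient α) (i + 2)) := by
  simpa only [neg_neg] using (isConvergentSeq_neg hα).neg_shift

theorem D_neg {α : ℝ} (hα : Irrational α) (c : ℚ) (n : ℕ) :
    D (-α) c n = -D α (1 - c) n := by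
  induction n with
  | zero => simp [D_zero]
  | succ n ih =>
    have hy : Irrational (((n + 1 : ℕ) : ℝ) * α) := hα.natCast_mul n.succ_ne_zero
    have hf := irrational_fract hy
    have hne : Int.fract (((n + 1 : ℕ) : ℝ) * α) ≠ 1 - c := fun h => hf.ne_rat (1 - c) (by
      rw [h]; push_cast; ring)
    rw [D_succ, D_succ, ih, mul_neg, Int.fract_neg hf.ne_zero]
    rcases hne.lt_or_gt with h | h
    · rw [if_neg (by linarith), if_pos h]; ring
    · rw [if_pos (by linarith), if_neg (by linarith)]; ring

theorem bddBelow_D_iff_neg {α : ℝ} (hα : Irrational α) {h k : ℕ} (h_lt : h < k) :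
    BddBelow (Set.range (D α (h / k))) ↔
      BddAbove (Set.range (D (-α) ((k - h : ℕ) / k))) := by
  have hk : (k : ℝ) ≠ 0 := by exact_mod_cast (Nat.zero_le _).trans_lt h_lt |>.ne'
  have e : D (-α) ((k - h : ℕ) / k) = -D α (h / k) := by
    funext n
    have := D_neg hα (((k - h : ℕ) : ℚ) / k) n
    push_cast at this
    rw [this, Pi.neg_apply, Nat.cast_sub h_lt.le]
    congr 2
    field_simp; ring
  have hrange : Set.range (-D α (h / k)) = -Set.range (D α (h / k)) := by
    ext y; simp [neg_eq_iff_eq_neg]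
  rw [e, hrange, bddAbove_neg]

theorem shiftedDen_congr {a b : ℕ → ℤ} (i : ℕ) (hab : ∀ j, j + 2 ≤ i → a j = b j) :
    shiftedDen a i = shiftedDen b i := by
  induction i using Nat.twoStepInduction with
  | zero => rfl
  | one => rfl
  | more i ih₁ ih₂ =>
    rw [shiftedDen, shiftedDen, ih₁ fun j hj => hab j (by omega), ih₂ fun j hj => hab j (by omega),
      hab i le_rfl]

theorem isCoprime_shiftedDen (a : ℕ → ℤ) (i : ℕ) :
    IsCoprime (shiftedDen a i) (shiftedDen a (i + 1)) := by
  induction i with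
  | zero => exact isCoprime_one_left
  | succ i ih =>
    rw [shiftedDen]
    exact (IsCoprime.mul_add_right_right_iff).2 ih.symm

theorem convDen_eq (α : ℝ) {m : ℤ} {i : ℕ} (h : m + 2 = i) :
    convDen α m = shiftedDen (partialQuotient α) i := by
  rw [convDen, den, h, Int.toNat_natCast]

theorem character_initialTuple (k : ℕ) (α : ℝ) {m : ℤ} {i : ℕ} (h : m + 1 = i) :
    character k (initialTuple α m) = (shiftedDen (partialQuotient α) i % k,
      shiftedDen (partialQuotient α) (i + 1) % k) := by
  have hlen : (initialTuple α m).length = i := by simp [initialTuple, h]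
  have hden : ∀ j, j ≤ i + 1 → shiftedDen (fun l => (initialTuple α m).getD l 0) j
      = shiftedDen (partialQuotient α) j := by
    intro j hj
    refine shiftedDen_congr j fun l hl => ?_
    have hl' : l < i := by omega
    simp [initialTuple, h, hl']
  simp only [character, tupleDen, den, hlen]
  rw [show ((i : ℤ) - 1 - 1 + 2).toNat = i by omega,
    show ((i : ℤ) - 1 + 2).toNat = i + 1 by omega, hden _ (by omega), hden _ le_rfl]

/-- The divisibility and type conditions agree index by index, since consecutive denominators are
coprime. -/
theorem forall_dvd_convDen_iff (α : ℝ) {k : ℕ} (hk : 2 ≤ k) {m : ℤ} (hm : -1 ≤ m) :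
    (∀ n : ℕ, (k : ℤ) ∣ convDen α (m + 2 * (n : ℤ))) ↔
      IsOfType k (initialTuple α m) ∧
        ∀ n : ℕ, 1 ≤ n → (k : ℤ) ∣ partialQuotient α (m + 2 * (n : ℤ)).toNat := by
  obtain ⟨i, hi⟩ : ∃ i : ℕ, m + 1 = i := ⟨(m + 1).toNat, by omega⟩
  set S := shiftedDen (partialQuotient α) with hS
  have hconv : ∀ n : ℕ, convDen α (m + 2 * (n : ℤ)) = S (i + 1 + 2 * n) := fun n =>
    convDen_eq α (by push_cast; omega)
  have hquot : ∀ n : ℕ, (m + 2 * ((n + 1 : ℕ) : ℤ)).toNat = i + 1 + 2 * n := fun n => by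
    push_cast; omega
  have htype : IsOfType k (initialTuple α m) ↔ (k : ℤ) ∣ S (i + 1) := by
    simp only [IsOfType, character_initialTuple k α hi, Prod.mk.injEq, ← hS]
    constructor
    · rintro ⟨j, -, -, -, h⟩
      exact Int.dvd_of_emod_eq_zero h
    · intro h
      refine ⟨S i % k, ?_, ?_, rfl, Int.emod_eq_zero_of_dvd h⟩
      · have h0 := Int.emod_nonneg (S i) (by omega : (k : ℤ) ≠ 0)
        have hne : S i % k ≠ 0 := fun h0 => by
          have hu := (isCoprime_shiftedDen (partialQuotient α) i).isUnit_of_dvd'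
            (Int.dvd_of_emod_eq_zero h0) h
          have := Int.natAbs_of_isUnit hu
          simp at this; omega
        omega
      · have := Int.emod_lt_of_pos (S i) (by omega : (0 : ℤ) < k)
        omega
  have step : ∀ n, (k : ℤ) ∣ S (i + 1 + 2 * n) →
      ((k : ℤ) ∣ S (i + 1 + 2 * (n + 1)) ↔ (k : ℤ) ∣ partialQuotient α (i + 1 + 2 * n)) :=
    fun n h => dvd_iff_dvd_of_isCoprime (isCoprime_shiftedDen _ _) rfl h
  simp only [hconv, htype]
  constructor
  · refine fun h => ⟨h 0, fun n hn => ?_⟩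
    obtain ⟨n, rfl⟩ := Nat.exists_eq_add_of_le' hn
    rw [hquot]
    exact (step n (h n)).1 (h (n + 1))
  · rintro ⟨h0, h⟩ n
    induction n with
    | zero => exact h0
    | succ n ih =>
      have := h (n + 1) (by omega)
      rw [hquot] at this
      exact (step n ih).2 this

theorem exists_even_dvd_convDen_iff (α : ℝ) (k : ℕ) :
    (∃ m : ℤ, -1 ≤ m ∧ Even m ∧ ∀ n : ℕ, (k : ℤ) ∣ convDen α (m + 2 * (n : ℤ))) ↔
      ∃ m : ℕ, ∀ n, (k : ℤ) ∣ shiftedDen (partialQuotient α) (2 * (m + n) + 2) := by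
  constructor
  · rintro ⟨m, hm, ⟨r, hr⟩, h⟩
    refine ⟨r.toNat, fun n => ?_⟩
    rw [← convDen_eq α (m := m + 2 * n) (by push_cast; omega)]
    exact h n
  · rintro ⟨m, h⟩
    refine ⟨2 * m, by omega, even_two_mul _, fun n => ?_⟩
    rw [convDen_eq α (i := 2 * (m + n) + 2) (by push_cast; ring)]
    exact h n

theorem exists_odd_dvd_convDen_iff (α : ℝ) (k : ℕ) :
    (∃ m : ℤ, -1 ≤ m ∧ Odd m ∧ ∀ n : ℕ, (k : ℤ) ∣ convDen α (m + 2 * (n : ℤ))) ↔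
      ∃ m : ℕ, ∀ n, (k : ℤ) ∣ shiftedDen (partialQuotient α) (2 * (m + n) + 1) := by
  constructor
  · rintro ⟨m, hm, ⟨r, hr⟩, h⟩
    refine ⟨(r + 1).toNat, fun n => ?_⟩
    rw [← convDen_eq α (m := m + 2 * n) (by push_cast; omega)]
    exact h n
  · rintro ⟨m, h⟩
    refine ⟨2 * m - 1, by omega, ⟨m - 1, by ring⟩, fun n => ?_⟩
    rw [convDen_eq α (i := 2 * (m + n) + 1) (by push_cast; ring)]
    exact h n

end LocalDiscrepancy

theorem theorem1p2 (α : ℝ) (hα : Irrational α) (h k : ℕ) (h_pos : 0 < h) (h_lt : h < k)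
    (h_coprime : Nat.Coprime h k) :
    List.TFAE [
      BddAbove (Set.range (LocalDiscrepancy.D α ((h : ℝ) / (k : ℝ)))),
      ∃ m : ℤ, -1 ≤ m ∧ Even m ∧
        ∀ n : ℕ, (k : ℤ) ∣ LocalDiscrepancy.convDen α (m + 2 * (n : ℤ)),
      ∃ m : ℤ, -1 ≤ m ∧ Even m ∧
        LocalDiscrepancy.IsOfType k (LocalDiscrepancy.initialTuple α m) ∧
        ∀ n : ℕ, 1 ≤ n →
          (k : ℤ) ∣ LocalDiscrepancy.partialQuotient α (m + 2 * (n : ℤ)).toNat] ∧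
    List.TFAE [
      BddBelow (Set.range (LocalDiscrepancy.D α ((h : ℝ) / (k : ℝ)))),
      ∃ m : ℤ, -1 ≤ m ∧ Odd m ∧
        ∀ n : ℕ, (k : ℤ) ∣ LocalDiscrepancy.convDen α (m + 2 * (n : ℤ)),
      ∃ m : ℤ, -1 ≤ m ∧ Odd m ∧
        LocalDiscrepancy.IsOfType k (LocalDiscrepancy.initialTuple α m) ∧
        ∀ n : ℕ, 1 ≤ n →
          (k : ℤ) ∣ LocalDiscrepancy.partialQuotient α (m + 2 * (n : ℤ)).toNat] := by
  have hcongr : ∀ par : ℤ → Prop,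
      (∃ m : ℤ, -1 ≤ m ∧ par m ∧
        ∀ n : ℕ, (k : ℤ) ∣ LocalDiscrepancy.convDen α (m + 2 * (n : ℤ))) ↔
      ∃ m : ℤ, -1 ≤ m ∧ par m ∧
        LocalDiscrepancy.IsOfType k (LocalDiscrepancy.initialTuple α m) ∧
        ∀ n : ℕ, 1 ≤ n →
          (k : ℤ) ∣ LocalDiscrepancy.partialQuotient α (m + 2 * (n : ℤ)).toNat := fun par =>
    exists_congr fun m => and_congr_right fun hm => and_congr_right fun _ =>
      LocalDiscrepancy.forall_dvd_convDen_iff α (by omega) hm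
  constructor
  · tfae_have 1 ↔ 2 := by
      rw [LocalDiscrepancy.exists_even_dvd_convDen_iff]
      exact LocalDiscrepancy.bddAbove_D_iff (LocalDiscrepancy.isConvergentSeq hα) hα
        h_pos h_lt h_coprime
    tfae_have 2 ↔ 3 := hcongr Even
    tfae_finish
  · tfae_have 1 ↔ 2 := by
      rw [LocalDiscrepancy.exists_odd_dvd_convDen_iff, LocalDiscrepancy.bddBelow_D_iff_neg hα h_lt]
      exact LocalDiscrepancy.bddAbove_D_iff (LocalDiscrepancy.isConvergentSeq_neg hα) hα.neg
        (by omega) (by omega) ((Nat.coprime_self_sub_left h_lt.le).2 h_coprime)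
    tfae_have 2 ↔ 3 := hcongr Odd
    tfae_finish
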